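/- Let $\{0,1\}^*$ be the set of finite binary strings. A function $r\colon\{0,1\}^*\to[0,1]$ is a \emph{lower-computable semi-measure} if $\sum_{s\in\{0,1\}^*}r(s)\le 1$ and there is a total recursive function $f\colon\mathbb{N}^+\times\{0,1\}^*\to\mathbb{Q}$ such that, for every $s$, $\lim_{n\to\infty}f(n,s)=r(s)$ and $f(n,s)\le r(s)$ for all $n\in\mathbb{N}^+$. A lower-computable semi-measure $m$ is a \emph{universal probability} if for every lower-computable semi-measure $r$ there is a real number $c>0$ such that $c\,r(s)\le m(s)$ for all $s\in\{0,1\}^*$. Let $m$ be a universal probability. Then for every infinite recursively enumerable set $A\subseteq\{0,1\}^*$ the sum $$-\sum_{s\in A}m(s)\log_2 m(s)$$ diverges to $\infty$. In particular, the Shannon entropy $-\sum_{s\in\{0,1\}^*}m(s)\log_2 m(s)$ of $m$ is infinite. -/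

import Mathlib

open Filter

/-- A total function into `ℚ` is recursive if the map to the (numerator, denominator) pair of the
value, written in lowest terms with positive denominator, is recursive. -/
def RatRecursive {α : Type} [Primcodable α] (f : α → ℚ) : Prop :=
  Computable fun x => ((f x).num, (f x).den)

/-- Lower-computable semi-measures on `{0,1}*` (finite binary strings are `List Bool`): functions
`r : {0,1}* → [0,1]` of total mass at most one that are limits of a recursive family of rational
lower bounds. -/
structure IsLowerComputableSemimeasure (r : List Bool → ℝ) : Prop where
  mem_Icc : ∀ s, r s ∈ Set.Icc (0 : ℝ) 1
  summable : Summable r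
  tsum_le_one : ∑' s, r s ≤ 1
  lower_computable : ∃ f : ℕ+ × List Bool → ℚ, RatRecursive f ∧
    ∀ s, Tendsto (fun n : ℕ+ => (f (n, s) : ℝ)) atTop (nhds (r s)) ∧
      ∀ n : ℕ+, (f (n, s) : ℝ) ≤ r s

/-- A universal probability: a lower-computable semi-measure that dominates every
lower-computable semi-measure up to a positive constant factor. -/
structure IsUniversalProbability (m : List Bool → ℝ) : Prop where
  semimeasure : IsLowerComputableSemimeasure m
  dominates : ∀ r : List Bool → ℝ, IsLowerComputableSemimeasure r →
    ∃ c : ℝ, 0 < c ∧ ∀ s, c * r s ≤ m s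

/-! Every such `A` carries a computable semi-measure `r` of infinite entropy. An increasing
computable enumeration of part of `A` has decidable range, so its `k`-th element can be given weight
`1 / W k`, with `W k` a constant times `(k+1) (log (k+1) + 1)^2`, and all other strings weight `0`.
The weights are summable, but the extra factor `log (W k)` leaves a series like `∑ 1 / (k log k)`
(`exists_computable_infinite_entropy`). Since `m ≥ c r` and `-x log x` increases on `[0, 1/e]`,
where all but finitely many values of `m` lie, the divergence passes to `m`
(`not_summable_negMulLog_of_le`). -/

theorem primrec_natLog_two : Primrec (Nat.log 2) := by
  have hpow : Primrec₂ ((· ^ ·) : ℕ → ℕ → ℕ) := Primrec₂.unpaired'.1 Nat.Primrec.pow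
  have hp : PrimrecRel fun n k : ℕ => 2 ^ k ≤ n :=
    Primrec.nat_le.comp₂ (hpow.comp₂ (Primrec₂.const 2) Primrec₂.right) Primrec₂.left
  refine (Primrec.nat_findGreatest Primrec.id hp).of_eq fun n => ?_
  rcases n.eq_zero_or_pos with rfl | hn
  · simp
  · refine (Nat.findGreatest_eq_iff).2 ⟨?_, fun _ => Nat.pow_log_le_self 2 hn.ne', ?_⟩
    · exact Nat.log_le_self 2 n
    · intro k hk _
      exact not_le.2 (Nat.lt_pow_of_log_lt one_lt_two hk)

/-- An infinite recursively enumerable set contains an infinite set that is enumerated in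
increasing order (of codes) by a computable function. -/
theorem REPred.exists_strictMono_computable {α : Type*} [Primcodable α] {A : Set α}
    (hA : A.Infinite) (hre : REPred fun a => a ∈ A) :
    ∃ h : ℕ → ℕ, Computable h ∧ StrictMono h ∧ ∀ k, ∃ a ∈ A, Encodable.encode a = h k := by
  obtain ⟨c, hc⟩ := Nat.Partrec.Code.exists_code.1 (Partrec.bind_decode₂_iff.1 hre)
  have hdom : ∀ i, (∃ x, x ∈ c.eval i) ↔ ∃ a ∈ A, Encodable.encode a = i := by
    intro i
    rw [hc]
    simp [Encodable.decode₂_eq_some, Part.mem_bind_iff, Part.mem_assert_iff, and_comm]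
  -- Dovetailing: `n` codes a step bound and a candidate element beyond `p`.
  let P : ℕ → ℕ → Bool := fun p n =>
    decide (p < n.unpair.2) && (Nat.Partrec.Code.evaln n.unpair.1 c n.unpair.2).isSome
  have hP : Primrec₂ P := by
    have h1 : Primrec₂ fun p n : ℕ => decide (p < n.unpair.2) :=
      (Primrec.nat_lt.comp Primrec.fst
        (Primrec.snd.comp (Primrec.unpair.comp Primrec.snd))).decide
    have h2 : Primrec fun n : ℕ =>
        (Nat.Partrec.Code.evaln n.unpair.1 c n.unpair.2).isSome :=
      Primrec.option_isSome.comp (Nat.Partrec.Code.primrec_evaln.comp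
        (((Primrec.fst.comp Primrec.unpair).pair (Primrec.const c)).pair
          (Primrec.snd.comp Primrec.unpair)))
    exact Primrec.and.comp₂ h1 (h2.comp₂ Primrec₂.right)
  have hex : ∀ p, ∃ n, P p n = true := by
    intro p
    obtain ⟨i, ⟨a, ha, rfl⟩, hi⟩ :=
      (hA.image Encodable.encode_injective.injOn).exists_gt p
    obtain ⟨x, hx⟩ := (hdom _).2 ⟨a, ha, rfl⟩
    obtain ⟨k, hk⟩ := Nat.Partrec.Code.evaln_complete.1 hx
    refine ⟨Nat.pair k (Encodable.encode a), ?_⟩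
    simp only [P, Nat.unpair_pair, Bool.and_eq_true, decide_eq_true_eq]
    exact ⟨hi, Option.isSome_iff_exists.2 ⟨x, hk⟩⟩
  let next : ℕ → ℕ := fun p => (Nat.find (hex p)).unpair.2
  have hfind : Computable fun p => Nat.find (hex p) := by
    refine (Partrec.rfind (p := fun p n => Part.some (P p n))
      hP.to_comp.partrec₂).of_eq fun p => ?_
    refine Part.eq_some_iff.2 (Nat.mem_rfind.2 ⟨?_, fun {m} hm => ?_⟩)
    · simpa using (Nat.find_spec (hex p)).symm
    · simpa using (Nat.find_min (hex p) hm)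
  have hnext : Computable next :=
    (Primrec.snd.comp Primrec.unpair).to_comp.comp hfind
  have hspec : ∀ p, p < next p ∧ ∃ a ∈ A, Encodable.encode a = next p := by
    intro p
    obtain ⟨hlt, hsome⟩ := Bool.and_eq_true_iff.1 (Nat.find_spec (hex p))
    refine ⟨of_decide_eq_true hlt, (hdom _).1 ?_⟩
    obtain ⟨x, hx⟩ := Option.isSome_iff_exists.1 hsome
    exact ⟨x, Nat.Partrec.Code.evaln_sound hx⟩
  refine ⟨fun k => Nat.rec (next 0) (fun _ p => next p) k, ?_, ?_, ?_⟩
  · exact Computable.nat_rec Computable.id (Computable.const _)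
      (hnext.comp (Computable.snd.comp Computable.snd)).to₂
  · exact strictMono_nat_of_lt_succ fun k => (hspec _).1
  · rintro (_ | k)
    · exact (hspec _).2
    · exact (hspec _).2

/-- The value `W k` at the `k`-th element of the range of `h`, and `0` off this range. -/
theorem exists_computable_extend {h W : ℕ → ℕ} (hc : Computable h) (hm : StrictMono h)
    (hW : Computable W) :
    ∃ q : ℕ → ℕ, Computable q ∧ (∀ k, q (h k) = W k) ∧ ∀ x, x ∉ Set.range h → q x = 0 := by
  let g : ℕ → ℕ → ℕ := fun x n =>
    Nat.rec 0 (fun k v => bif decide (h k = x) then W k else v) n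
  have hg0 : ∀ x n, (∀ k < n, h k ≠ x) → g x n = 0 := by
    intro x n
    induction n with
    | zero => intro _; rfl
    | succ n ih =>
      intro H
      change (bif decide (h n = x) then W n else g x n) = 0
      rw [ih fun k hk => H k (by omega)]
      simp [H n (by omega)]
  have hgW : ∀ k n, k < n → g (h k) n = W k := by
    intro k n
    induction n with
    | zero => intro H; omega
    | succ n ih =>
      intro H
      change (bif decide (h n = h k) then W n else g (h k) n) = W k
      rcases Nat.lt_succ_iff_lt_or_eq.1 H with H | rfl
      · rw [ih H]
        simp [hm.injective.eq_iff, H.ne']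
      · simp
  -- Since `k ≤ h k`, only indices `k ≤ x` can satisfy `h k = x`.
  refine ⟨fun x => g x (x + 1), ?_, fun k => hgW k _ (Nat.lt_succ_of_le (hm.id_le k)),
    fun x hx => hg0 x (x + 1) fun k _ hk => hx ⟨k, hk⟩⟩
  have hstep : Computable₂ fun (x : ℕ) (y : ℕ × ℕ) =>
      bif decide (h y.1 = x) then W y.1 else y.2 :=
    Computable.cond ((Primrec.eq (α := ℕ)).decide.to_comp.comp
      (hc.comp (Computable.fst.comp Computable.snd)) Computable.fst)
      (hW.comp (Computable.fst.comp Computable.snd)) (Computable.snd.comp Computable.snd)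
  exact Computable.nat_rec Computable.succ (Computable.const 0) hstep

theorem antitone_weight (j : ℕ) : ∀ ⦃m n : ℕ⦄, 0 < m → m ≤ n →
    ((n : ℝ) * ((Nat.log 2 n : ℝ) + 1) ^ j)⁻¹ ≤ ((m : ℝ) * ((Nat.log 2 m : ℝ) + 1) ^ j)⁻¹ := by
  intro m n hm hmn
  have hm' : (0 : ℝ) < m := by exact_mod_cast hm
  have h1 : (m : ℝ) ≤ n := by exact_mod_cast hmn
  have h2 : (Nat.log 2 m : ℝ) ≤ Nat.log 2 n := by exact_mod_cast Nat.log_mono_right hmn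
  gcongr

/-- Cauchy condensation reduces this to `∑ 1 / (k+1)^j`. -/
theorem summable_inv_mul_natLog_pow_iff (j : ℕ) :
    (Summable fun n : ℕ => ((n : ℝ) * ((Nat.log 2 n : ℝ) + 1) ^ j)⁻¹) ↔ 1 < j := by
  rw [← summable_condensed_iff_of_nonneg (fun n => by positivity) (antitone_weight j)]
  have : (fun k : ℕ => (2 : ℝ) ^ k *
      (((2 ^ k : ℕ) : ℝ) * ((Nat.log 2 (2 ^ k) : ℝ) + 1) ^ j)⁻¹) =
      fun k : ℕ => (((k + 1 : ℕ) : ℝ) ^ j)⁻¹ := by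
    funext k
    rw [Nat.log_pow one_lt_two]
    push_cast
    field_simp
  rw [this, summable_nat_add_iff (f := fun k : ℕ => ((k : ℝ) ^ j)⁻¹) 1]
  exact Real.summable_nat_pow_inv

/-- A computable sequence of probabilities of infinite entropy. -/
theorem exists_computable_infinite_entropy :
    ∃ W : ℕ → ℕ, Computable W ∧ (∀ k, 2 ≤ W k) ∧ Summable (fun k => (W k : ℝ)⁻¹) ∧
      ∑' k, (W k : ℝ)⁻¹ ≤ 1 ∧ ¬ Summable fun k => (W k : ℝ)⁻¹ * Real.log (W k) := by
  let V : ℕ → ℝ := fun k => (((k + 1 : ℕ) : ℝ) * ((Nat.log 2 (k + 1) : ℝ) + 1) ^ 2)⁻¹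
  have hV : Summable V := (summable_nat_add_iff (f := fun n : ℕ =>
    ((n : ℝ) * ((Nat.log 2 n : ℝ) + 1) ^ 2)⁻¹) 1).2
      ((summable_inv_mul_natLog_pow_iff 2).2 one_lt_two)
  -- The factor `M + 2` brings the total mass below one and forces `2 ≤ W k`.
  obtain ⟨M, hM⟩ := exists_nat_ge (∑' k, V k)
  have hWV : ∀ k, (((M + 2) * ((k + 1) * (Nat.log 2 (k + 1) + 1) ^ 2) : ℕ) : ℝ)⁻¹ =
      ((M : ℝ) + 2)⁻¹ * V k := by
    intro k
    simp only [V]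
    push_cast
    rw [mul_inv]
  have hpos : ∀ k, 0 < (k + 1) * (Nat.log 2 (k + 1) + 1) ^ 2 := fun k => by positivity
  refine ⟨fun k => (M + 2) * ((k + 1) * (Nat.log 2 (k + 1) + 1) ^ 2), ?_, ?_, ?_, ?_, ?_⟩
  · have hL : Primrec fun k => Nat.log 2 (k + 1) + 1 :=
      Primrec.succ.comp (primrec_natLog_two.comp Primrec.succ)
    refine Primrec.to_comp (Primrec.nat_mul.comp (Primrec.const _)
      (Primrec.nat_mul.comp Primrec.succ ((Primrec.nat_mul.comp hL hL).of_eq fun k => ?_)))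
    ring
  · intro k
    nlinarith [hpos k]
  · simp only [hWV]
    exact hV.mul_left _
  · simp only [hWV]
    rw [tsum_mul_left, inv_mul_le_one₀ (by positivity)]
    linarith
  · intro hS
    have h1 : ¬ Summable fun k : ℕ =>
        (((k + 1 : ℕ) : ℝ) * ((Nat.log 2 (k + 1) : ℝ) + 1) ^ 1)⁻¹ := by
      rw [summable_nat_add_iff (f := fun n : ℕ => ((n : ℝ) * ((Nat.log 2 n : ℝ) + 1) ^ 1)⁻¹) 1,
        summable_inv_mul_natLog_pow_iff]
      exact lt_irrefl 1
    refine h1 ((hS.mul_left (((M : ℝ) + 2) / Real.log 2)).of_nonneg_of_le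
      (fun k => by positivity) fun k => ?_)
    rw [hWV]
    have hlog2 : 0 < Real.log 2 := Real.log_pos one_lt_two
    -- This makes `log (W k)` large enough to cancel one of the two logarithmic factors.
    have hpow : 2 ^ (Nat.log 2 (k + 1) + 1) ≤
        (M + 2) * ((k + 1) * (Nat.log 2 (k + 1) + 1) ^ 2) := by
      have h2 : 2 ^ Nat.log 2 (k + 1) ≤ k + 1 := Nat.pow_log_le_self 2 k.succ_ne_zero
      calc 2 ^ (Nat.log 2 (k + 1) + 1) = 2 * (2 ^ Nat.log 2 (k + 1) * 1) := by ring
        _ ≤ (M + 2) * ((k + 1) * (Nat.log 2 (k + 1) + 1) ^ 2) := by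
          gcongr
          · omega
          · exact Nat.one_le_pow _ _ (Nat.succ_pos _)
    have hlog : ((Nat.log 2 (k + 1) : ℝ) + 1) * Real.log 2 ≤
        Real.log (((M + 2) * ((k + 1) * (Nat.log 2 (k + 1) + 1) ^ 2) : ℕ) : ℝ) := by
      have := Real.log_le_log (by positivity) (Nat.cast_le (α := ℝ).2 hpow)
      rwa [Nat.cast_pow, Real.log_pow, Nat.cast_succ, Nat.cast_ofNat] at this
    calc (((k + 1 : ℕ) : ℝ) * ((Nat.log 2 (k + 1) : ℝ) + 1) ^ 1)⁻¹
        = ((M : ℝ) + 2) / Real.log 2 * (((M : ℝ) + 2)⁻¹ * V k *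
          (((Nat.log 2 (k + 1) : ℝ) + 1) * Real.log 2)) := by
          simp only [V]
          field_simp
      _ ≤ _ := by
          have : 0 ≤ V k := by positivity
          gcongr

theorem ratRecursive_inv_natCast {α : Type} [Primcodable α] {q : α → ℕ} (hq : Computable q) :
    RatRecursive fun x => ((q x : ℚ))⁻¹ := by
  refine (Computable.nat_casesOn hq (Computable.const ((0 : ℤ), 1))
    ((Computable.const (1 : ℤ)).pair (Computable.succ.comp Computable.snd)).to₂).of_eq
      fun x => ?_
  rw [Rat.inv_natCast_num, Rat.inv_natCast_den]
  rcases q x with _ | n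
  · simp
  · simp

theorem negMulLog_le_negMulLog {x y : ℝ} (hx : 0 ≤ x) (hxy : x ≤ y) (hy : y ≤ Real.exp (-1)) :
    Real.negMulLog x ≤ Real.negMulLog y := by
  have := Real.mul_log_strictAntiOn.antitoneOn ⟨hx, hxy.trans hy⟩ ⟨hx.trans hxy, hy⟩ hxy
  simp only [Real.negMulLog]
  linarith

/-- Infinite entropy passes from a nonnegative family to a summable one that dominates it. -/
theorem not_summable_negMulLog_of_le {ι : Type*} {p m : ι → ℝ} {c : ℝ} (hc : 0 < c)
    (hp : ∀ i, 0 ≤ p i) (hp1 : ∀ i, p i ≤ 1) (hm : Summable m) (hle : ∀ i, c * p i ≤ m i)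
    (hS : ¬ Summable fun i => Real.negMulLog (p i)) :
    ¬ Summable fun i => Real.negMulLog (m i) := by
  intro hm'
  -- With `d ≤ 1`, the term `p i * negMulLog d` is nonnegative and can be dropped below.
  let d := min c 1
  have hd : 0 < d := lt_min hc one_pos
  have hle' : ∀ i, d * p i ≤ m i := fun i =>
    (mul_le_mul_of_nonneg_right (min_le_left _ _) (hp i)).trans (hle i)
  have hev : ∀ᶠ i in cofinite, m i ≤ Real.exp (-1) :=
    (hm.tendsto_cofinite_zero.eventually_lt_const (Real.exp_pos _)).mono fun _ h => h.le
  refine hS ((hm'.mul_left d⁻¹).of_norm_bounded_eventually (hev.mono fun i hi => ?_))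
  rw [Real.norm_of_nonneg (Real.negMulLog_nonneg (hp i) (hp1 i)), le_inv_mul_iff₀ hd]
  have h1 := negMulLog_le_negMulLog (mul_nonneg hd.le (hp i)) (hle' i) hi
  rw [Real.negMulLog_mul] at h1
  have h2 := mul_nonneg (hp i) (Real.negMulLog_nonneg hd.le (min_le_right _ _))
  linarith

/-- Every infinite recursively enumerable set carries a lower-computable semi-measure whose
entropy is infinite along an injective sequence in the set. -/
theorem exists_semimeasure_infinite_entropy {A : Set (List Bool)} (hA : A.Infinite)
    (hre : REPred fun s => s ∈ A) :
    ∃ r, IsLowerComputableSemimeasure r ∧ ∃ a : ℕ → A, Function.Injective a ∧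
      ¬ Summable fun k => Real.negMulLog (r (a k)) := by
  obtain ⟨h, hc, hmono, hmem⟩ := hre.exists_strictMono_computable hA
  obtain ⟨W, hW, hW2, hsum, hsum1, hent⟩ := exists_computable_infinite_entropy
  obtain ⟨q, hq, hqh, hq0⟩ := exists_computable_extend hc hmono hW
  choose a haA ha using hmem
  have hinj : Function.Injective a := fun i j hij =>
    hmono.injective (by rw [← ha, ← ha, hij])
  -- Off the enumerated strings `q` is `0`, and `0⁻¹ = 0` gives weight zero.
  let r : List Bool → ℝ := fun s => (q (Encodable.encode s) : ℝ)⁻¹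
  have hra : ∀ k, r (a k) = (W k : ℝ)⁻¹ := fun k => by simp only [r, ha, hqh]
  have hr0 : ∀ s ∉ Set.range a, r s = 0 := by
    intro s hs
    have : q (Encodable.encode s) = 0 := hq0 _ fun ⟨k, hk⟩ =>
      hs ⟨k, Encodable.encode_injective ((ha k).trans hk)⟩
    simp [r, this]
  have hcomp : r ∘ a = fun k => (W k : ℝ)⁻¹ := funext hra
  refine ⟨r, ⟨fun s => ⟨by positivity, Nat.cast_inv_le_one _⟩, ?_, ?_, ?_⟩,
    fun k => ⟨a k, haA k⟩, fun i j hij => hinj (congrArg Subtype.val hij), ?_⟩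
  · rwa [← hinj.summable_iff hr0, hcomp]
  · have : ∑' k, r (a k) = ∑' s, r s :=
      hinj.tsum_eq fun s hs => by_contra fun hs' => hs (hr0 s hs')
    rw [← this]
    simpa only [hra] using hsum1
  · refine ⟨fun x => (q (Encodable.encode x.2) : ℚ)⁻¹,
      ratRecursive_inv_natCast (hq.comp (Computable.encode.comp Computable.snd)), fun s => ?_⟩
    simp [r]
  · simpa [hra, Real.negMulLog] using hent

theorem IsUniversalProbability.not_summable_negMulLog {m : List Bool → ℝ}
    (hm : IsUniversalProbability m) {A : Set (List Bool)} (hA : A.Infinite)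
    (hre : REPred fun s => s ∈ A) : ¬ Summable fun s : A => Real.negMulLog (m s) := by
  obtain ⟨r, hr, a, ha, hS⟩ := exists_semimeasure_infinite_entropy hA hre
  obtain ⟨c, hc, hle⟩ := hm.dominates r hr
  intro hsum
  exact not_summable_negMulLog_of_le hc (fun k => (hr.mem_Icc _).1) (fun k => (hr.mem_Icc _).2)
    (hm.semimeasure.summable.comp_injective (Subtype.val_injective.comp ha)) (fun k => hle _) hS
    (hsum.comp_injective ha)

theorem tendsto_sum_atTop_of_not_summable {ι : Type*} {f : ι → ℝ} (hf : ∀ i, 0 ≤ f i)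
    (hS : ¬ Summable f) : Tendsto (fun F : Finset ι => ∑ i ∈ F, f i) atTop atTop := by
  refine tendsto_atTop_atTop_of_monotone
    (fun s t hst => Finset.sum_le_sum_of_subset_of_nonneg hst fun i _ _ => hf i) fun b => ?_
  by_contra! H
  exact hS (summable_of_sum_le hf fun u => (H u).le)

theorem tendsto_entropy_atTop {ι : Type*} {p : ι → ℝ} (hp : ∀ i, p i ∈ Set.Icc (0 : ℝ) 1)
    (hS : ¬ Summable fun i => Real.negMulLog (p i)) :
    Tendsto (fun F : Finset ι => -∑ i ∈ F, p i * Real.logb 2 (p i)) atTop atTop := by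
  have hlog2 : 0 < Real.log 2 := Real.log_pos one_lt_two
  refine ((tendsto_sum_atTop_of_not_summable
    (fun i => Real.negMulLog_nonneg (hp i).1 (hp i).2) hS).atTop_div_const hlog2).congr
      fun F => ?_
  rw [Finset.sum_div, ← Finset.sum_neg_distrib]
  refine Finset.sum_congr rfl fun i _ => ?_
  rw [Real.negMulLog, Real.logb]
  ring

/-- Divergence to `∞` of a sum is convergence to `∞` of the net of its finite partial sums. -/
theorem corollary3p3 (m : List Bool → ℝ) (hm : IsUniversalProbability m) :
    (∀ A : Set (List Bool), A.Infinite → REPred (fun s => s ∈ A) →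
      Tendsto (fun F : Finset A => -∑ s ∈ F, m s * Real.logb 2 (m s)) atTop atTop) ∧
    Tendsto (fun F : Finset (List Bool) => -∑ s ∈ F, m s * Real.logb 2 (m s)) atTop atTop := by
  refine ⟨fun A hA hre => tendsto_entropy_atTop (fun s => hm.semimeasure.mem_Icc s)
    (hm.not_summable_negMulLog hA hre),
    tendsto_entropy_atTop hm.semimeasure.mem_Icc fun hsum => ?_⟩
  have hre : REPred fun s : List Bool => s ∈ Set.univ :=
    (Partrec.dom_re (Computable.const ()).partrec).of_eq fun s => by simp
  exact hm.not_summable_negMulLog Set.infinite_univ hre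
    (hsum.comp_injective Subtype.val_injective)
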